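/- Let $\Gamma$ be a (discrete) group that satisfies a non-trivial law, i.e. there are a free group $F$ and an element $\omega\in F$, $\omega\neq 1$, such that $\rho(\omega)=1$ for every homomorphism $\rho\colon F\to\Gamma$. Then $$H_b^2(\Gamma;\mathbb{R})=0.$$ Here $H_b^\ast(\Gamma;\mathbb{R})$ is the bounded cohomology of $\Gamma$ with trivial real coefficients, that is, $H_b^n(\Gamma;\mathbb{R})=Z_b^n/B_b^n$ with $Z_b^n=\ker\delta^n\cap C_b^n(\Gamma;\mathbb{R})^\Gamma$ and $B_b^n=\delta^{n-1}\big(C_b^{n-1}(\Gamma;\mathbb{R})^\Gamma\big)$ (and $B_b^0=0$), where $C_b^n(\Gamma;\mathbb{R})$ is the space of bounded functions $f\colon\Gamma^{n+1}\to\mathbb{R}$ with the action $(\gamma\cdot f)(g_0,\dots,g_n)=f(\gamma^{-1}g_0,\dots,\gamma^{-1}g_n)$, and $\delta^n f(g_0,\dots,g_{n+1})=\sum_{i=0}^{n+1}(-1)^i f(g_0,\dots,\widehat{g_i},\dots,g_{n+1})$. -/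

import Mathlib

/-- `ω` is a law of the group `Γ`, where `ω` is an element of a free group `F`:
every homomorphism `F → Γ` sends `ω` to the identity. -/
def IsGroupLaw {F : Type*} [Group F] [IsFreeGroup F] (ω : F) (Γ : Type*) [Group Γ] : Prop :=
  ∀ ρ : F →* Γ, ρ ω = 1

namespace BddCohomology

section Cochains

variable (Γ : Type*) (V : Type*) [NormedAddCommGroup V] [NormedSpace ℝ V]

/-- The bounded functions `C_b^n(Γ; V)` among all functions `Γ^(n+1) → V`. -/
def bddCochains (n : ℕ) : Submodule ℝ ((Fin (n + 1) → Γ) → V) where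
  carrier := {f | ∃ C : ℝ, ∀ g, ‖f g‖ ≤ C}
  zero_mem' := ⟨0, fun g => by simp⟩
  add_mem' := by
    rintro f₁ f₂ ⟨C₁, h₁⟩ ⟨C₂, h₂⟩
    exact ⟨C₁ + C₂, fun g => (norm_add_le _ _).trans (add_le_add (h₁ g) (h₂ g))⟩
  smul_mem' := by
    rintro c f ⟨C, h⟩
    refine ⟨‖c‖ * C, fun g => ?_⟩
    rw [Pi.smul_apply, norm_smul]
    exact mul_le_mul_of_nonneg_left (h g) (norm_nonneg c)

/-- The simplicial coboundary operator
`(δ f)(g₀, …, gₙ₊₁) = ∑ i, (-1)^i f(g₀, …, ĝᵢ, …, gₙ₊₁)`. -/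
def coboundary (n : ℕ) : ((Fin (n + 1) → Γ) → V) →ₗ[ℝ] ((Fin (n + 2) → Γ) → V) where
  toFun f := fun g => ∑ i : Fin (n + 2), (-1 : ℝ) ^ (i : ℕ) • f (fun j => g (i.succAbove j))
  map_add' f₁ f₂ := by
    ext g
    simp [Finset.sum_add_distrib]
  map_smul' c f := by
    ext g
    simp [Finset.smul_sum, smul_comm c]

theorem coboundary_coboundary (n : ℕ) (f : (Fin (n + 1) → Γ) → V) :
    coboundary Γ V (n + 1) (coboundary Γ V n f) = 0 := by
  ext g
  change ∑ i : Fin (n + 3), (-1 : ℝ) ^ (i : ℕ) • ∑ j : Fin (n + 2), (-1 : ℝ) ^ (j : ℕ) •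
    f (fun k => g (i.succAbove (j.succAbove k))) = 0
  simp_rw [Finset.smul_sum, smul_smul, ← pow_add]
  rw [← Finset.sum_product']
  refine Finset.sum_involution (fun p _ => (p.1.succAbove p.2, p.2.predAbove p.1)) ?_ ?_ ?_ ?_
  · rintro ⟨i, j⟩ -
    simp only [Fin.succAbove_succAbove_succAbove_predAbove, Fin.neg_one_pow_succAbove_add_predAbove]
    module
  · rintro ⟨i, j⟩ - - h
    exact Fin.succAbove_ne i j (congrArg Prod.fst h)
  · simp
  · rintro ⟨i, j⟩ -
    simp [Fin.succAbove_succAbove_predAbove, Fin.predAbove_predAbove_succAbove]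

theorem coboundary_mem_bddCochains {n : ℕ} {f : (Fin (n + 1) → Γ) → V}
    (hf : f ∈ bddCochains Γ V n) : coboundary Γ V n f ∈ bddCochains Γ V (n + 1) := by
  obtain ⟨C, h⟩ := hf
  refine ⟨∑ _i : Fin (n + 2), C, fun g => ?_⟩
  change ‖∑ i : Fin (n + 2), (-1 : ℝ) ^ (i : ℕ) • f (fun j => g (i.succAbove j))‖ ≤ _
  refine norm_sum_le_of_le _ fun i _ => ?_
  rw [norm_smul, norm_pow, norm_neg, norm_one, one_pow, one_mul]
  exact h _

end Cochains

section Cohomology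

variable {Γ : Type*} [Group Γ] {V : Type*} [NormedAddCommGroup V] [NormedSpace ℝ V]

/-- The functions `Γ^(n+1) → V` that are invariant under the action
`(γ • f)(g₀, …, gₙ) = γ f(γ⁻¹ g₀, …, γ⁻¹ gₙ)`, where `Γ` acts on `V`
by linear isometric isomorphisms through `ρ`. -/
def invariants (ρ : Γ →* (V ≃ₗᵢ[ℝ] V)) (n : ℕ) : Submodule ℝ ((Fin (n + 1) → Γ) → V) where
  carrier := {f | ∀ γ g, ρ γ (f (fun i => γ⁻¹ * g i)) = f g}
  zero_mem' := fun γ g => by simp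
  add_mem' := by
    intro f₁ f₂ h₁ h₂ γ g
    simpa using congrArg₂ (· + ·) (h₁ γ g) (h₂ γ g)
  smul_mem' := by
    intro c f h γ g
    simpa using congrArg (c • ·) (h γ g)

/-- The bounded cocycles `Z_b^n(Γ; V) = ker δ^n ∩ C_b^n(Γ; V)^Γ`. -/
def cocycles (ρ : Γ →* (V ≃ₗᵢ[ℝ] V)) (n : ℕ) : Submodule ℝ ((Fin (n + 1) → Γ) → V) :=
  LinearMap.ker (coboundary Γ V n) ⊓ (bddCochains Γ V n ⊓ invariants ρ n)

/-- The bounded coboundaries `B_b^n(Γ; V) = δ^(n-1)(C_b^(n-1)(Γ; V)^Γ)`, which are `0` for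
`n = 0`. -/
def coboundaries (ρ : Γ →* (V ≃ₗᵢ[ℝ] V)) : (n : ℕ) → Submodule ℝ ((Fin (n + 1) → Γ) → V)
  | 0 => ⊥
  | n + 1 => (bddCochains Γ V n ⊓ invariants ρ n).map (coboundary Γ V n)

/-- Coboundaries are cocycles. -/
theorem coboundaries_le_cocycles (ρ : Γ →* (V ≃ₗᵢ[ℝ] V)) (n : ℕ) :
    coboundaries ρ n ≤ cocycles ρ n := by
  cases n with
  | zero => exact bot_le
  | succ n =>
    rintro _ ⟨f, hf, rfl⟩
    refine ⟨coboundary_coboundary Γ V n f, coboundary_mem_bddCochains Γ V hf.1, fun γ g => ?_⟩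
    simp only [coboundary, LinearMap.coe_mk, AddHom.coe_mk, map_sum, map_smul]
    exact Finset.sum_congr rfl fun i _ => congrArg _ (hf.2 γ _)

end Cohomology

end BddCohomology

/-- The bounded cohomology `H_b^n(Γ; V) = Z_b^n(Γ; V) / B_b^n(Γ; V)` of the discrete group `Γ`,
where `Γ` acts on `V` by linear isometric isomorphisms through `ρ`. -/
abbrev BddCohomology {Γ : Type*} [Group Γ] {V : Type*} [NormedAddCommGroup V] [NormedSpace ℝ V]
    (ρ : Γ →* (V ≃ₗᵢ[ℝ] V)) (n : ℕ) : Type _ :=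
  BddCohomology.cocycles ρ n ⧸
    (BddCohomology.coboundaries ρ n).submoduleOf (BddCohomology.cocycles ρ n)

/-- The bounded cohomology `H_b^n(Γ; ℝ)`, where `Γ` acts trivially on `ℝ`. -/
abbrev RealBddCohomology (Γ : Type*) [Group Γ] (n : ℕ) : Type _ :=
  BddCohomology (1 : Γ →* (ℝ ≃ₗᵢ[ℝ] ℝ)) n

/-!
A bounded cocycle `c` on `Γ` defines a central extension `E` of `Γ` by `ℝ`, and on `E` the pullback
of `c` is the defect of the quasimorphism `(g, s) ↦ s`. Let `ψ` be its homogenization. If `ψ` is a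
homomorphism, then it is the identity on the central copy of `ℝ`, because it is at bounded distance
from it, and comparing `(g, 0) * (h, 0)` with `(g * h, 0)` shows that `c` is the coboundary of the
bounded function `g ↦ ψ (g, 0)` (`RealCocycle.exists_bounded_primitive`).

If `w` is a law of `Γ`, then the values of `w` in `E` are central. So it remains to see that a
homogeneous quasimorphism `φ` on a group `E` in which `w ≠ 1` takes only central values is a
homomorphism (`IsHomogeneousQuasimorphism.map_mul_of_central_law`). Otherwise the supremum `S` of
`φ (x * y) - φ x - φ y` is positive. Choose `a`, `b` for which it is nearly attained, and subtract
the exponent sums weighted by `φ a` and `φ b`, which amounts to passing to `χ (x, s) = φ x - s`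
on `E × ℝ`. Then `χ` vanishes on the powers of (lifts of) `a` and `b`, and is nearly `N * S` at
`(a * b) ^ N`. Since `χ` is invariant under conjugation, inserting a power of `a` or `b` anywhere in
a word changes `χ` by at most `S`. Counting the insertions that turn `(a * b) ^ N` into a word
`∏ a ^ nᵢ * b ^ mᵢ` gives, up to an error that is small with the slack in the choice of `a` and `b`,
`χ (∏ a ^ nᵢ * b ^ mᵢ) ≥ S / 2 * ∑ (sign nᵢ + sign mᵢ)` (`pow_le_of_blockProd`).

The contradiction comes from a word that is trivial in `E × ℝ` but has positive sum of signs
(`exists_blockProd_eq_one`). Take the commutator of `w`, made cyclically reduced, with a new letter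
`z`, number the letters and their inverses by distinct integers `α l`, and substitute
`b ^ α l * a ^ (± 1) * b ^ (-α l⁻¹)` for the letter `l`. Between consecutive letters `l`, `l'` the
exponent of `b` is `α l' - α l⁻¹`, which is nonzero in a reduced word. The signs coming from `w` and
from `w⁻¹` cancel, and the four at `z` and `z⁻¹` add up to `2` if the numbering is chosen suitably,
which is possible because the first letter of `w` is not the inverse of the last one.
-/

/-! ### Homogeneous quasimorphisms -/

/-- A real function `φ` on a group whose defect `φ (g * h) - φ g - φ h` is bounded. -/
def IsQuasimorphism {G : Type*} [Group G] (φ : G → ℝ) : Prop :=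
  ∃ D : ℝ, ∀ g h, |φ (g * h) - φ g - φ h| ≤ D

/-- A quasimorphism with `φ (g ^ n) = n * φ g`. It is enough to ask this for natural exponents. -/
structure IsHomogeneousQuasimorphism {G : Type*} [Group G] (φ : G → ℝ) : Prop where
  isQuasimorphism : IsQuasimorphism φ
  map_pow : ∀ (g : G) (n : ℕ), φ (g ^ n) = n * φ g

theorem eq_zero_of_forall_nat_mul_abs_le {x C : ℝ} (h : ∀ n : ℕ, n * |x| ≤ C) : x = 0 := by
  by_contra hx
  obtain ⟨n, hn⟩ := exists_nat_gt (C / |x|)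
  rw [div_lt_iff₀ (abs_pos.2 hx)] at hn
  exact (h n).not_gt hn

namespace IsHomogeneousQuasimorphism

variable {G : Type*} [Group G] {φ : G → ℝ}

theorem map_one (hφ : IsHomogeneousQuasimorphism φ) : φ 1 = 0 := by
  simpa using hφ.map_pow 1 0

theorem map_inv (hφ : IsHomogeneousQuasimorphism φ) (g : G) : φ g⁻¹ = -φ g := by
  obtain ⟨D, hD⟩ := hφ.isQuasimorphism
  refine eq_neg_of_add_eq_zero_left (eq_zero_of_forall_nat_mul_abs_le (C := D) fun n => ?_)
  have := hD (g⁻¹ ^ n) (g ^ n)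
  rw [inv_pow, inv_mul_cancel, ← inv_pow, hφ.map_pow, hφ.map_pow, hφ.map_one] at this
  have h : |n * (φ g⁻¹ + φ g)| ≤ D := by
    rw [abs_le] at this ⊢
    constructor <;> linarith
  rwa [abs_mul, Nat.abs_cast] at h

theorem map_zpow (hφ : IsHomogeneousQuasimorphism φ) (g : G) (n : ℤ) : φ (g ^ n) = n * φ g := by
  obtain ⟨n, rfl | rfl⟩ := n.eq_nat_or_neg
  · simpa using hφ.map_pow g n
  · simp [hφ.map_inv, hφ.map_pow]

theorem map_conj (hφ : IsHomogeneousQuasimorphism φ) (g h : G) : φ (h * g * h⁻¹) = φ g := by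
  obtain ⟨D, hD⟩ := hφ.isQuasimorphism
  refine sub_eq_zero.1 (eq_zero_of_forall_nat_mul_abs_le (C := D + D) fun n => ?_)
  have h₁ := hD (h * g ^ n) h⁻¹
  have h₂ := hD h (g ^ n)
  rw [← conj_pow, hφ.map_inv, hφ.map_pow] at h₁
  rw [hφ.map_pow] at h₂
  rw [← Nat.abs_cast n, ← abs_mul]
  refine le_trans (le_of_eq ?_) ((abs_add_le _ _).trans (add_le_add h₁ h₂))
  congr 1
  ring

end IsHomogeneousQuasimorphism

/-- Every quasimorphism is at bounded distance from a homogeneous one, its homogenization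
`g ↦ lim φ (g ^ n) / n`. -/
theorem IsQuasimorphism.exists_homogeneous {G : Type*} [Group G] {φ : G → ℝ}
    (hφ : IsQuasimorphism φ) :
    ∃ ψ : G → ℝ, IsHomogeneousQuasimorphism ψ ∧ ∃ C, ∀ g, |ψ g - φ g| ≤ C := by
  obtain ⟨D, hD⟩ := hφ
  have hpow (g : G) (n : ℕ) (hn : n ≠ 0) : |φ (g ^ n) - n * φ g| ≤ n * D := by
    induction n, Nat.one_le_iff_ne_zero.2 hn using Nat.le_induction with
    | base => simpa using (abs_nonneg _).trans (hD 1 1)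
    | succ n hn ih =>
      refine le_trans (le_of_eq ?_)
        ((abs_add_le _ _).trans (add_le_add (ih (by omega)) (hD (g ^ n) g))) |>.trans_eq ?_
      · congr 1; rw [pow_succ]; push_cast; ring
      · push_cast; ring
  have hdiv (g : G) (n : ℕ) (hn : n ≠ 0) : |φ (g ^ n) / n - φ g| ≤ D := by
    have hn' : (0 : ℝ) < n := by positivity
    have h := hpow g n hn
    have e : φ (g ^ n) - n * φ g = n * (φ (g ^ n) / n - φ g) := by field_simp
    rw [e, abs_mul, Nat.abs_cast] at h
    exact le_of_mul_le_mul_left h hn'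
  have hlim (g : G) : ∃ l, Filter.Tendsto (fun n : ℕ => φ (g ^ n) / n) Filter.atTop (nhds l) := by
    -- Fekete's lemma applies after adding the constant `D`, which disappears in the limit.
    have hsub : Subadditive fun n => φ (g ^ n) + D := fun m n => by
      have := (abs_le.1 (hD (g ^ m) (g ^ n))).2
      rw [← pow_add] at this
      linarith
    have hbdd : BddBelow (Set.range fun n : ℕ => (φ (g ^ n) + D) / n) := by
      refine ⟨min 0 (φ g - D), ?_⟩
      rintro _ ⟨n, rfl⟩
      rcases eq_or_ne n 0 with rfl | hn
      · simp
      · have h₁ := (abs_le.1 (hdiv g n hn)).1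
        have h₂ : 0 ≤ D / n := div_nonneg ((abs_nonneg _).trans (hD 1 1)) n.cast_nonneg
        simp only [add_div]
        exact (min_le_right _ _).trans (by linarith)
    refine ⟨hsub.lim, ?_⟩
    simpa [add_div] using (hsub.tendsto_lim hbdd).sub (tendsto_const_div_atTop_nhds_zero_nat D)
  choose ψ hψ using hlim
  have hclose (g : G) : |ψ g - φ g| ≤ D :=
    le_of_tendsto ((hψ g).sub_const _).abs
      ((Filter.eventually_ne_atTop 0).mono fun n hn => hdiv g n hn)
  refine ⟨ψ, ⟨⟨D + D + (D + D), fun g h => ?_⟩, fun g k => ?_⟩, D, hclose⟩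
  · have h₀ := abs_le.1 (hD g h)
    have h₁ := abs_le.1 (hclose (g * h))
    have h₂ := abs_le.1 (hclose g)
    have h₃ := abs_le.1 (hclose h)
    exact abs_le.2 ⟨by linarith, by linarith⟩
  · rcases eq_or_ne k 0 with rfl | hk
    · have h₁ : Filter.Tendsto (fun n : ℕ => φ ((g ^ 0) ^ n) / n) Filter.atTop (nhds 0) := by
        simpa using tendsto_const_div_atTop_nhds_zero_nat (φ 1)
      simpa using tendsto_nhds_unique (hψ (g ^ 0)) h₁
    · refine tendsto_nhds_unique (hψ (g ^ k)) ?_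
      refine (((hψ g).comp (Filter.tendsto_id.const_mul_atTop' hk.bot_lt)).const_mul
        (k : ℝ)).congr fun n => ?_
      have : (k : ℝ) ≠ 0 := by exact_mod_cast hk
      simp only [Function.comp_apply, id_eq, Nat.cast_mul, pow_mul]
      field_simp

/-! ### Words in two elements of value zero -/

/-- The sign of an integer, where `0` counts as negative. -/
noncomputable def strictSign (n : ℤ) : ℝ := if 0 < n then 1 else -1

/-- The product `∏ a ^ nᵢ * b ^ mᵢ` over a list of pairs `(nᵢ, mᵢ)`. -/
def blockProd {H : Type*} [Group H] (a b : H) (P : List (ℤ × ℤ)) : H :=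
  (P.map fun p => a ^ p.1 * b ^ p.2).prod

/-- The sum of the signs of all exponents in a list of pairs. -/
noncomputable def signSum (P : List (ℤ × ℤ)) : ℝ :=
  (P.map fun p => strictSign p.1 + strictSign p.2).sum

section Insertion

variable {H : Type*} [Group H] {χ : H → ℝ} {D : ℝ}

/-- The element `c` can be moved to the end of the word by a conjugation, which `χ` does not see. -/
theorem le_of_insert (hχ : ∀ x y, χ (x * y) ≤ χ x + χ y + D)
    (hconj : ∀ x y, χ (y * x * y⁻¹) = χ x) {c : H} (hc : χ c = 0) (u v : H) :
    χ (u * c * v) ≤ χ (u * v) + D := by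
  have h := hχ (u * v) (v⁻¹ * c * v)
  have h' := hconj c v⁻¹
  rw [inv_inv] at h'
  rw [h', hc, add_zero] at h
  convert h using 2
  group

theorem le_of_zpow_replace (hχ : ∀ x y, χ (x * y) ≤ χ x + χ y + D)
    (hconj : ∀ x y, χ (y * x * y⁻¹) = χ x) {c : H} (hc : ∀ n : ℤ, χ (c ^ n) = 0) (u v : H)
    (n m : ℤ) : χ (u * c ^ n * v) ≤ χ (u * c ^ m * v) + D := by
  have h := le_of_insert hχ hconj (hc (n - m)) (u * c ^ m) v
  rwa [mul_assoc u, ← zpow_add, add_sub_cancel] at h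

/-- The exponent `(n - 1).toNat + 1` is `n` if `n` is positive and `1` otherwise: it costs `D` to make
a positive exponent nonpositive. -/
theorem le_of_zpow_toNat (hχ : ∀ x y, χ (x * y) ≤ χ x + χ y + D)
    (hconj : ∀ x y, χ (y * x * y⁻¹) = χ x) {c : H} (hc : ∀ n : ℤ, χ (c ^ n) = 0) (u v : H)
    (n : ℤ) : χ (u * c ^ ((n - 1).toNat + 1) * v) ≤
      χ (u * c ^ n * v) + (1 - strictSign n) / 2 * D := by
  rcases lt_or_ge 0 n with hn | hn
  · have : (((n - 1).toNat + 1 : ℕ) : ℤ) = n := by omega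
    rw [← zpow_natCast, this]
    simp [strictSign, hn]
  · rw [← zpow_natCast]
    convert le_of_zpow_replace hχ hconj hc u v _ n using 2
    norm_num [strictSign, hn.not_gt]

variable {a b : H}

/-- A block `a ^ (n + 1) * b ^ (k + 1)` with positive exponents arises from `(a * b) ^ (n + k + 1)`
by deleting `n` letters `b` and `k` letters `a`. -/
theorem pow_le_of_pos_block (hχ : ∀ x y, χ (x * y) ≤ χ x + χ y + D)
    (hconj : ∀ x y, χ (y * x * y⁻¹) = χ x) (ha : ∀ n : ℤ, χ (a ^ n) = 0)
    (hb : ∀ n : ℤ, χ (b ^ n) = 0) (n k : ℕ) (u v : H) :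
    χ (u * (a * b) ^ (n + k + 1) * v) ≤ χ (u * a ^ (n + 1) * (b ^ (k + 1) * v)) + (n + k) * D := by
  have ha1 : χ a = 0 := by simpa using ha 1
  have hb1 : χ b = 0 := by simpa using hb 1
  induction n generalizing u with
  | zero =>
    induction k generalizing v with
    | zero => simp [mul_assoc]
    | succ k ih =>
      have h₁ := ih (a * b * v)
      have h₂ := le_of_insert hχ hconj ha1 (u * a * b ^ (k + 1)) (b * v)
      have e₁ : u * (a * b) ^ (0 + k + 1) * (a * b * v)
          = u * (a * b) ^ (0 + (k + 1) + 1) * v := by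
        rw [show 0 + (k + 1) + 1 = (0 + k + 1) + 1 by ring, pow_succ _ (0 + k + 1)]
        simp only [mul_assoc]
      have e₂ : u * a ^ (0 + 1) * (b ^ (k + 1) * (a * b * v))
          = u * a * b ^ (k + 1) * a * (b * v) := by simp [mul_assoc]
      have e₃ : u * a ^ (0 + 1) * (b ^ (k + 1 + 1) * v)
          = u * a * b ^ (k + 1) * (b * v) := by simp [mul_assoc, pow_succ]
      rw [e₁, e₂] at h₁
      rw [e₃]
      push_cast at h₁ ⊢
      linarith
  | succ n ih =>
    have h₁ := ih (u * (a * b))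
    have h₂ := le_of_insert hχ hconj hb1 (u * a) (a ^ (n + 1) * (b ^ (k + 1) * v))
    have e₁ : u * (a * b) * (a * b) ^ (n + k + 1) * v = u * (a * b) ^ (n + 1 + k + 1) * v := by
      rw [show n + 1 + k + 1 = (n + k + 1) + 1 by ring, pow_succ' _ (n + k + 1)]
      simp only [mul_assoc]
    have e₂ : u * (a * b) * a ^ (n + 1) * (b ^ (k + 1) * v)
        = u * a * b * (a ^ (n + 1) * (b ^ (k + 1) * v)) := by simp only [mul_assoc]
    have e₃ : u * a ^ (n + 1 + 1) * (b ^ (k + 1) * v)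
        = u * a * (a ^ (n + 1) * (b ^ (k + 1) * v)) := by
      rw [pow_succ' a (n + 1)]; simp only [mul_assoc]
    rw [e₁, e₂] at h₁
    rw [e₃]
    push_cast at h₁ ⊢
    linarith

/-- The number of factors `a * b` from which `pow_le_of_blockProd` produces the blocks of `P`. -/
def blockLength (P : List (ℤ × ℤ)) : ℕ :=
  (P.map fun p => (p.1 - 1).toNat + (p.2 - 1).toNat + 1).sum

/-- If `χ` vanishes on the powers of `a` and of `b`, then its value on a word in `a` and `b` is
bounded below by its value on a power of `a * b` and the signs of the exponents. -/
theorem pow_le_of_blockProd (hχ : ∀ x y, χ (x * y) ≤ χ x + χ y + D)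
    (hconj : ∀ x y, χ (y * x * y⁻¹) = χ x) (ha : ∀ n : ℤ, χ (a ^ n) = 0)
    (hb : ∀ n : ℤ, χ (b ^ n) = 0) (P : List (ℤ × ℤ)) (u : H) :
    χ (u * (a * b) ^ blockLength P) ≤
      χ (u * blockProd a b P) + (blockLength P - signSum P / 2) * D := by
  induction P generalizing u with
  | nil => simp [blockLength, blockProd, signSum]
  | cons p P ih =>
    obtain ⟨n, m⟩ := p
    set n' := (n - 1).toNat with hn'
    set m' := (m - 1).toNat with hm'
    have h₁ := pow_le_of_pos_block hχ hconj ha hb n' m' u ((a * b) ^ blockLength P)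
    have h₂ := le_of_zpow_toNat hχ hconj ha u (b ^ (m' + 1) * (a * b) ^ blockLength P) n
    have h₃ := le_of_zpow_toNat hχ hconj hb (u * a ^ n) ((a * b) ^ blockLength P) m
    have h₄ := ih (u * a ^ n * b ^ m)
    rw [← hn'] at h₂
    rw [← hm', mul_assoc (u * a ^ n) (b ^ _)] at h₃
    have e₁ : blockLength ((n, m) :: P) = n' + m' + 1 + blockLength P := by
      simp [blockLength, hn', hm']
    have e₂ : signSum ((n, m) :: P) = strictSign n + strictSign m + signSum P := by
      simp [signSum]
    have e₃ : u * blockProd a b ((n, m) :: P) = u * a ^ n * b ^ m * blockProd a b P := by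
      simp [blockProd, mul_assoc]
    rw [e₁, e₂, e₃, pow_add, ← mul_assoc]
    push_cast
    linarith

end Insertion

/-! ### Cyclic words and their turns -/

section Letters

variable {κ : Type*}

/-- The inverse of a letter. -/
def invLetter (l : κ × Bool) : κ × Bool := (l.1, !l.2)

/-- The exponent `1` or `-1` of a letter. -/
def letterExp (l : κ × Bool) : ℤ := if l.2 then 1 else -1

@[simp] theorem invLetter_invLetter (l : κ × Bool) : invLetter (invLetter l) = l := by
  simp [invLetter]

@[simp] theorem letterExp_invLetter (l : κ × Bool) : letterExp (invLetter l) = -letterExp l := by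
  rcases l with ⟨i, _ | _⟩ <;> simp [letterExp, invLetter]

theorem invRev_eq_map_reverse (L : List (κ × Bool)) :
    FreeGroup.invRev L = (L.map invLetter).reverse := rfl

theorem strictSign_letterExp (l : κ × Bool) : strictSign (letterExp l) = letterExp l := by
  rcases l with ⟨i, _ | _⟩ <;> simp [letterExp, strictSign]

theorem strictSign_add_neg {n : ℤ} (hn : n ≠ 0) : strictSign n + strictSign (-n) = 0 := by
  rcases lt_or_gt_of_ne hn with h | h
  · simp [strictSign, h, h.not_gt]
  · simp [strictSign, h, h.not_gt]

/-- The element `b ^ α l * a ^ (± 1) * b ^ (-α l⁻¹)` substituted for the letter `l`. The values of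
`l` and `l⁻¹` are inverse to each other, and between consecutive letters `l` and `l'` the exponent
of `b` is `α l' - α l⁻¹`. -/
def letterValue {H : Type*} [Group H] (a b : H) (α : κ × Bool → ℤ) (l : κ × Bool) : H :=
  b ^ α l * a ^ letterExp l * b ^ (-α (invLetter l))

theorem letterValue_invLetter {H : Type*} [Group H] (a b : H) (α : κ × Bool → ℤ) (l : κ × Bool) :
    letterValue a b α (invLetter l) = (letterValue a b α l)⁻¹ := by
  simp [letterValue, mul_assoc]

variable (α : κ × Bool → ℤ)

/-- The exponents of `a` and `b` in the word obtained from `L`, followed by the letter `e`, by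
substituting `letterValue`, except for the power of `b` at the beginning. -/
def wordBlocks : List (κ × Bool) → κ × Bool → List (ℤ × ℤ)
  | [], _ => []
  | l :: L, e => (letterExp l, α (L.headD e) - α (invLetter l)) :: wordBlocks L e

/-- The sum of the signs of the exponents of `b` in `wordBlocks`. -/
noncomputable def turnSum : List (κ × Bool) → κ × Bool → ℝ
  | [], _ => 0
  | l :: L, e => strictSign (α (L.headD e) - α (invLetter l)) + turnSum L e

theorem prod_letterValue_mul {H : Type*} [Group H] (a b : H) (L : List (κ × Bool))
    (e : κ × Bool) :
    (L.map (letterValue a b α)).prod * b ^ α e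
      = b ^ α (L.headD e) * blockProd a b (wordBlocks α L e) := by
  induction L with
  | nil => simp [blockProd, wordBlocks]
  | cons l L ih =>
    rw [List.map_cons, List.prod_cons, mul_assoc, ih]
    simp only [blockProd, wordBlocks, letterValue, List.map_cons, List.prod_cons, List.headD_cons,
      mul_assoc]
    rw [← mul_assoc (b ^ (-_)), ← zpow_add, neg_add_eq_sub]

theorem signSum_wordBlocks (L : List (κ × Bool)) (e : κ × Bool) :
    signSum (wordBlocks α L e) = (L.map fun l => (letterExp l : ℝ)).sum + turnSum α L e := by
  induction L with
  | nil => simp [signSum, wordBlocks, turnSum]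
  | cons l L ih =>
    simp only [signSum, wordBlocks, turnSum, List.map_cons, List.sum_cons] at ih ⊢
    rw [ih, strictSign_letterExp]
    ring

theorem sum_letterExp_invRev (L : List (κ × Bool)) :
    ((FreeGroup.invRev L).map fun l => (letterExp l : ℝ)).sum
      = -(L.map fun l => (letterExp l : ℝ)).sum := by
  rw [invRev_eq_map_reverse, List.map_reverse, List.sum_reverse, List.map_map]
  induction L with
  | nil => simp
  | cons l L ih =>
    simp only [List.map_cons, List.sum_cons, Function.comp_apply, letterExp_invLetter] at ih ⊢
    rw [ih]
    push_cast
    ring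

theorem turnSum_append (L M : List (κ × Bool)) (e : κ × Bool) :
    turnSum α (L ++ M) e = turnSum α L (M.headD e) + turnSum α M e := by
  induction L with
  | nil => simp [turnSum]
  | cons l L ih =>
    have : (L ++ M).headD e = L.headD (M.headD e) := by cases L <;> rfl
    simp only [List.cons_append, turnSum, ih, this, add_assoc]

/-- Reading a path backwards reverses all its turns. -/
theorem turnSum_add_turnSum_invRev (x e : κ × Bool) (L : List (κ × Bool))
    (h : (x :: L ++ [e]).IsChain fun l l' => α l' ≠ α (invLetter l)) :
    turnSum α (x :: L) e
      + turnSum α (invLetter e :: FreeGroup.invRev L) (invLetter x) = 0 := by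
  induction L generalizing x with
  | nil =>
    have hne : α e - α (invLetter x) ≠ 0 := sub_ne_zero.2 (by simpa using h)
    have := strictSign_add_neg hne
    simpa [turnSum, FreeGroup.invRev] using this
  | cons y L ih =>
    simp only [List.cons_append, List.isChain_cons_cons] at h
    have hne : α y - α (invLetter x) ≠ 0 := sub_ne_zero.2 h.1
    have h₁ := strictSign_add_neg hne
    have h₂ := ih y (by simpa using h.2)
    have h₃ : invLetter e :: FreeGroup.invRev (y :: L)
        = (invLetter e :: FreeGroup.invRev L) ++ [invLetter y] := by
      simp [invRev_eq_map_reverse]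
    rw [h₃, turnSum_append]
    simp only [turnSum, List.headD_cons, List.headD_nil, invLetter_invLetter, neg_sub] at h₁ h₂ ⊢
    linarith

/-- The turns of the cyclic word `z⁻¹ L z L⁻¹`, where `L` is a cyclically reduced word with first
letter `x` and last letter `y⁻¹`. Those inside `L` and `L⁻¹` cancel, and the order
`z < x < z⁻¹ < y` makes the four turns at `z` and `z⁻¹` add up to `2`. -/
theorem turnSum_commutator {x y z : κ × Bool} {L : List (κ × Bool)}
    (hx : L.head? = some x) (hy : L.getLast? = some (invLetter y))
    (h : (invLetter z :: L ++ [z]).IsChain fun l l' => α l' ≠ α (invLetter l))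
    (h₁ : α z < α x) (h₂ : α x < α (invLetter z)) (h₃ : α (invLetter z) < α y) :
    turnSum α (invLetter z :: L ++ z :: FreeGroup.invRev L) (invLetter z) = 2 := by
  have h₀ := turnSum_add_turnSum_invRev α (invLetter z) z L h
  have hfirst : ∀ e, (FreeGroup.invRev L).headD e = y := by
    intro e
    simp [invRev_eq_map_reverse, List.headD_eq_head?_getD, hy]
  have hlast : ∃ M, FreeGroup.invRev L = M ++ [invLetter x] := by
    obtain ⟨M, rfl⟩ := List.head?_eq_some_iff.1 hx
    exact ⟨FreeGroup.invRev M, by simp [invRev_eq_map_reverse]⟩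
  obtain ⟨M, hM⟩ := hlast
  rw [turnSum_append]
  simp only [turnSum, hfirst, List.headD_cons, invLetter_invLetter] at h₀ ⊢
  rw [hM, turnSum_append] at h₀ ⊢
  simp only [turnSum, List.headD_cons, List.headD_nil, invLetter_invLetter, strictSign, sub_pos,
    h₂, h₃, h₁.not_gt, h₁.trans (h₂.trans h₃), if_true, if_false] at h₀ ⊢
  linarith

end Letters

/-! ### Central laws -/

/-- If every value of the nontrivial word `w` in `H` is central, then the commutator of `w` with
a further letter gives a word in two letters, with positive sum of signs, that is a law of `H`. -/
theorem exists_blockProd_eq_one {ι : Type*} (w : FreeGroup ι) (hw : w ≠ 1) (H : Type*) [Group H]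
    (hH : ∀ (f : ι → H) (z : H), Commute (FreeGroup.lift f w) z) :
    ∃ P, signSum P = 2 ∧ ∀ a b : H, blockProd a b P = 1 := by
  classical
  set L₀ := FreeGroup.reduceCyclically w.toWord with hL₀
  have hred : FreeGroup.IsCyclicallyReduced L₀ :=
    FreeGroup.reduceCyclically.isCyclicallyReduced FreeGroup.isReduced_toWord
  set g := FreeGroup.mk (FreeGroup.reduceCyclically.conjugator w.toWord) with hg
  have hwg : w = g * FreeGroup.mk L₀ * g⁻¹ := by
    rw [hg, hL₀, FreeGroup.inv_mk, FreeGroup.mul_mk, FreeGroup.mul_mk,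
      FreeGroup.reduceCyclically.conj_conjugator_reduceCyclically, FreeGroup.mk_toWord]
  have hne : L₀ ≠ [] := fun h => hw (by rw [hwg, h, ← FreeGroup.one_eq_mk]; simp)
  have hcomm (f : ι → H) (z : H) : Commute (FreeGroup.lift f (FreeGroup.mk L₀)) z := by
    have h := hH f (FreeGroup.lift f g)
    have h' := hH f z
    have e : FreeGroup.lift f w = FreeGroup.lift f (FreeGroup.mk L₀) := by
      rw [hwg, map_mul, map_mul, map_inv] at h ⊢
      have := h.eq
      rw [inv_mul_cancel_right] at this
      exact (mul_left_cancel this).symm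
    rwa [e] at h'
  -- The alphabet is enlarged by one letter `z`.
  let j : ι × Bool → Option ι × Bool := fun l => (some l.1, l.2)
  set L := L₀.map j with hL
  have hjinv (l) : j (invLetter l) = invLetter (j l) := rfl
  have hjinj : Function.Injective j := fun l l' h => by
    simp only [j, Prod.mk.injEq, Option.some.injEq] at h
    exact Prod.ext h.1 h.2
  let x := L₀.head hne
  let y := invLetter (L₀.getLast hne)
  let z : Option ι × Bool := (none, true)
  have hxy : x ≠ y := fun h => by
    have := hred.2 _ (List.getLast?_eq_getLast_of_ne_nil hne) _ (List.head?_eq_some_head hne)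
    simp only [x, y] at h
    rw [h] at this
    simp [invLetter] at this
  -- The numbering of the letters begins with `z < x < z⁻¹ < y`.
  set N := z :: j x :: invLetter z :: j y :: L with hN
  let α : Option ι × Bool → ℤ := fun l => (N.idxOf l : ℤ)
  have hα {l l'} (hl : l ∈ N) (h : l ≠ l') : α l ≠ α l' := fun h' =>
    h ((List.idxOf_inj hl).1 (Nat.cast_injective (R := ℤ) h'))
  have hjz (l) : j l ≠ z := fun h => by simp [j, z] at h
  have hjz' (l) : j l ≠ invLetter z := fun h => by simp [j, z, invLetter] at h
  have hzz : z ≠ invLetter z := by simp [z, invLetter]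
  have hjxy : j x ≠ j y := fun h => hxy (hjinj h)
  have αz : α z = 0 := by simp [α, hN]
  have αx : α (j x) = 1 := by
    simp only [α, hN, List.idxOf_cons_ne _ (hjz x).symm, List.idxOf_cons_self]
    rfl
  have αz' : α (invLetter z) = 2 := by
    simp only [α, hN, List.idxOf_cons_ne _ hzz, List.idxOf_cons_ne _ (hjz' x),
      List.idxOf_cons_self]
    rfl
  have αy : α (j y) = 3 := by
    simp only [α, hN, List.idxOf_cons_ne _ (hjz y).symm, List.idxOf_cons_ne _ hjxy,
      List.idxOf_cons_ne _ (hjz' y).symm, List.idxOf_cons_self]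
    rfl
  have hLj {l} (hl : l ∈ L) : ∃ l₀, j l₀ = l := by
    obtain ⟨l₀, -, h⟩ := List.mem_map.1 hl
    exact ⟨l₀, h⟩
  have hred' : (invLetter z :: L ++ [z]).IsChain fun l l' => l' ≠ invLetter l := by
    rw [List.cons_append, List.isChain_cons, List.isChain_append]
    refine ⟨?_, ?_, by simp, ?_⟩
    · intro l hl h
      rw [invLetter_invLetter] at h
      obtain ⟨l₀, rfl⟩ : ∃ l₀, j l₀ = l := by
        rw [List.head?_append_of_ne_nil _ (by simpa [hL] using hne)] at hl
        exact hLj (List.mem_of_mem_head? hl)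
      exact hjz l₀ h
    · rw [hL, List.isChain_map]
      refine hred.1.imp fun l l' h h' => ?_
      have h'' : l' = invLetter l := hjinj h'
      rw [h''] at h
      simp [invLetter] at h
    · intro l hl l' hl' h
      obtain ⟨l₀, rfl⟩ := hLj (List.mem_of_mem_getLast? hl)
      simp only [List.head?_cons, Option.mem_def, Option.some.injEq] at hl'
      exact hjz (invLetter l₀) (by rw [hjinv, ← h, hl'])
  have hchain : (invLetter z :: L ++ [z]).IsChain fun l l' => α l' ≠ α (invLetter l) :=
    hred'.imp_of_mem_imp fun l l' _ hl' h => hα (by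
      simp only [List.cons_append, List.mem_cons, List.mem_append, List.not_mem_nil,
        or_false] at hl'
      simp only [hN, List.mem_cons]
      tauto) h
  let W := invLetter z :: L ++ z :: FreeGroup.invRev L
  refine ⟨wordBlocks α W (invLetter z), ?_, fun a b => ?_⟩
  · rw [signSum_wordBlocks, turnSum_commutator (x := j x) (y := j y) α ?_ ?_ hchain]
    · simp only [W, List.cons_append, List.map_cons, List.map_append, List.sum_cons,
        List.sum_append, sum_letterExp_invRev, letterExp_invLetter]
      push_cast
      ring
    · rw [αz, αx]; norm_num
    · rw [αx, αz']; norm_num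
    · rw [αz', αy]; norm_num
    · rw [hL, List.head?_map, List.head?_eq_some_head hne]; rfl
    · rw [hL, List.getLast?_map, List.getLast?_eq_getLast_of_ne_nil hne]
      simp [y, hjinv]
  · let f : Option ι → H := fun i => letterValue a b α (i, true)
    have hval : letterValue a b α = fun l => cond l.2 (f l.1) (f l.1)⁻¹ := by
      funext ⟨i, s⟩
      cases s
      · exact letterValue_invLetter a b α (i, true)
      · rfl
    have hprod := prod_letterValue_mul α a b W (invLetter z)
    have hL' : FreeGroup.lift f (FreeGroup.mk L)
        = FreeGroup.lift (fun i => f (some i)) (FreeGroup.mk L₀) := by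
      rw [FreeGroup.lift_mk, FreeGroup.lift_mk, hL, List.map_map]
      rfl
    have hW : (W.map (letterValue a b α)).prod = 1 := by
      have e : FreeGroup.mk W
          = (FreeGroup.of none)⁻¹ * FreeGroup.mk L * FreeGroup.of none * (FreeGroup.mk L)⁻¹ := by
        simp [W, z, invLetter, FreeGroup.of, FreeGroup.inv_mk, FreeGroup.invRev]
      rw [hval, ← FreeGroup.lift_mk, e]
      simp only [map_mul, map_inv, hL']
      rw [mul_assoc (_⁻¹), (hcomm _ _).eq]
      group
    rw [hW, one_mul] at hprod
    exact mul_eq_left.1 hprod.symm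

/-! ### Quasimorphisms on groups with a central law -/

/-- On a group in which all values of a nontrivial word are central, every homogeneous
quasimorphism is a homomorphism. -/
theorem IsHomogeneousQuasimorphism.map_mul_of_central_law {ι : Type*} {w : FreeGroup ι}
    (hw : w ≠ 1) {E : Type*} [Group E]
    (hE : ∀ (f : ι → E) (z : E), Commute (FreeGroup.lift f w) z)
    {φ : E → ℝ} (hφ : IsHomogeneousQuasimorphism φ) (g h : E) : φ (g * h) = φ g + φ h := by
  -- It suffices to show that `φ` is subadditive.
  suffices key : ∀ g h, φ (g * h) - φ g - φ h ≤ 0 by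
    have h₁ := key g h
    have h₂ := key h⁻¹ g⁻¹
    rw [← mul_inv_rev, hφ.map_inv, hφ.map_inv, hφ.map_inv] at h₂
    linarith
  -- Otherwise the supremum `S` of the signed defects is positive.
  by_contra! hpos
  obtain ⟨g₀, h₀, hpos⟩ := hpos
  let d : E × E → ℝ := fun p => φ (p.1 * p.2) - φ p.1 - φ p.2
  have hbdd : BddAbove (Set.range d) := by
    obtain ⟨D, hD⟩ := hφ.isQuasimorphism
    exact ⟨D, by rintro _ ⟨p, rfl⟩; exact (abs_le.1 (hD p.1 p.2)).2⟩
  set S := ⨆ p, d p with hS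
  have hdS (x y : E) : φ (x * y) - φ x - φ y ≤ S := le_ciSup hbdd (x, y)
  have hS0 : 0 < S := hpos.trans_le (hdS g₀ h₀)
  have hH (f : ι → E × Multiplicative ℝ) (z : E × Multiplicative ℝ) : Commute (FreeGroup.lift f w) z := by
    refine Prod.ext ?_ (mul_comm _ _)
    have h := hE (fun i => (f i).1) z.1
    have e : FreeGroup.lift (fun i => (f i).1) w = (FreeGroup.lift f w).1 := by
      have : FreeGroup.lift (fun i => (f i).1)
          = (MonoidHom.fst E (Multiplicative ℝ)).comp (FreeGroup.lift f) := by
        ext i; simp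
      rw [this]; rfl
    rw [e] at h
    exact h.eq
  obtain ⟨P, hPsign, hP⟩ := exists_blockProd_eq_one w hw _ hH
  set N := blockLength P with hN
  -- The slack `ε = S / (N + 1)` is so small that losing it `N` times costs less than `S`.
  obtain ⟨⟨a, b⟩, hab⟩ := exists_lt_of_lt_ciSup
    (show S - S / (N + 1) < ⨆ p, d p from sub_lt_self _ (by positivity))
  -- On `E × ℝ`, the value of `φ` can be shifted to vanish on lifts of `a` and `b`.
  let χ : E × Multiplicative ℝ → ℝ := fun x => φ x.1 - x.2.toAdd
  have hχ (x y : E × Multiplicative ℝ) : χ (x * y) ≤ χ x + χ y + S := by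
    have := hdS x.1 y.1
    simp only [χ, Prod.fst_mul, Prod.snd_mul, toAdd_mul]
    linarith
  have hconj (x y : E × Multiplicative ℝ) : χ (y * x * y⁻¹) = χ x := by
    simp [χ, hφ.map_conj]
  let lift : E → E × Multiplicative ℝ := fun x => (x, .ofAdd (φ x))
  have hlift (x : E) (n : ℤ) : χ (lift x ^ n) = 0 := by
    simp [χ, lift, hφ.map_zpow]
  have hpow : χ ((lift a * lift b) ^ N) = N * d (a, b) := by
    simp only [χ, lift, d, Prod.pow_fst, Prod.pow_snd, Prod.mk_mul_mk, hφ.map_pow, toAdd_pow,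
      toAdd_mul, toAdd_ofAdd, nsmul_eq_mul]
    ring
  have hone : χ 1 = 0 := by simp [χ, hφ.map_one]
  have hle := pow_le_of_blockProd hχ hconj (hlift a) (hlift b) P 1
  rw [one_mul, one_mul, ← hN, hpow, hP, hone, hPsign] at hle
  have h₁ : N * (S - S / (N + 1)) ≤ N * d (a, b) :=
    mul_le_mul_of_nonneg_left hab.le N.cast_nonneg
  have h₂ : N * (S / (N + 1)) < S := by
    rw [← mul_div_assoc, div_lt_iff₀ (by positivity)]
    linarith
  linarith

/-! ### The central extension of a bounded cocycle -/

section Extension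

variable {Γ : Type*} [Group Γ]

/-- An inhomogeneous real 2-cocycle of the group `Γ` with trivial action. -/
structure RealCocycle (Γ : Type*) [Group Γ] where
  /-- The underlying function of two variables. -/
  toFun : Γ → Γ → ℝ
  cocycle : ∀ g h k, toFun g h + toFun (g * h) k = toFun h k + toFun g (h * k)

/-- The central extension of `Γ` by `ℝ` with cocycle `c`: the set `Γ × ℝ` with multiplication
`(g, s) * (h, t) = (g * h, s + t + c g h)`. The cocycle is not assumed to be normalized, so that
the identity is `(1, -c 1 1)`. -/
@[ext] structure RealCocycle.Extension (c : RealCocycle Γ) where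
  /-- The image in `Γ`. -/
  fst : Γ
  /-- The real coordinate. -/
  snd : ℝ

namespace RealCocycle

variable (c : RealCocycle Γ)

theorem one_left (g : Γ) : c.toFun 1 g = c.toFun 1 1 := by
  have := c.cocycle 1 1 g
  simp only [one_mul] at this
  linarith

theorem one_right (g : Γ) : c.toFun g 1 = c.toFun 1 1 := by
  have := c.cocycle g 1 1
  simp only [mul_one] at this
  linarith

theorem inv_left (g : Γ) : c.toFun g⁻¹ g = c.toFun g g⁻¹ := by
  have := c.cocycle g g⁻¹ g
  rw [mul_inv_cancel, inv_mul_cancel, c.one_left g, c.one_right g] at this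
  linarith

namespace Extension

variable {c}

instance : Mul c.Extension := ⟨fun x y => ⟨x.fst * y.fst, x.snd + y.snd + c.toFun x.fst y.fst⟩⟩

instance : One c.Extension := ⟨⟨1, -c.toFun 1 1⟩⟩

instance : Inv c.Extension :=
  ⟨fun x => ⟨x.fst⁻¹, -x.snd - c.toFun x.fst x.fst⁻¹ - c.toFun 1 1⟩⟩

@[simp] theorem fst_mul (x y : c.Extension) : (x * y).fst = x.fst * y.fst := rfl

@[simp] theorem snd_mul (x y : c.Extension) :
    (x * y).snd = x.snd + y.snd + c.toFun x.fst y.fst := rfl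

@[simp] theorem fst_one : (1 : c.Extension).fst = 1 := rfl

@[simp] theorem snd_one : (1 : c.Extension).snd = -c.toFun 1 1 := rfl

@[simp] theorem fst_inv (x : c.Extension) : x⁻¹.fst = x.fst⁻¹ := rfl

@[simp] theorem snd_inv (x : c.Extension) :
    x⁻¹.snd = -x.snd - c.toFun x.fst x.fst⁻¹ - c.toFun 1 1 := rfl

instance : Group c.Extension :=
  Group.ofLeftAxioms
    (fun x y z => by
      have := c.cocycle x.fst y.fst z.fst
      ext
      · simp [mul_assoc]
      · simp only [snd_mul, fst_mul]
        linarith)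
    (fun x => by ext <;> simp [c.one_left])
    (fun x => by
      ext
      · simp
      · simp only [snd_mul, snd_inv, fst_inv, c.inv_left, snd_one]
        ring)

/-- The projection of the extension to `Γ`. -/
def proj (c : RealCocycle Γ) : c.Extension →* Γ where
  toFun := fst
  map_one' := rfl
  map_mul' _ _ := rfl

/-- The kernel of the projection is central. -/
theorem commute_of_fst_eq_one {x : c.Extension} (hx : x.fst = 1) (y : c.Extension) :
    Commute x y := by
  ext
  · simp [hx]
  · simp only [snd_mul, hx, c.one_left y.fst, c.one_right y.fst]
    ring

/-- The inclusion of `ℝ` as the kernel of the projection, written multiplicatively. -/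
def ofReal (c : RealCocycle Γ) (t : ℝ) : c.Extension := ⟨1, t - c.toFun 1 1⟩

theorem mul_ofReal (x : c.Extension) (t : ℝ) : x * ofReal c t = ⟨x.fst, x.snd + t⟩ := by
  ext
  · simp [ofReal]
  · simp only [ofReal, snd_mul, c.one_right]
    ring

theorem ofReal_pow (t : ℝ) (n : ℕ) : ofReal c t ^ n = ofReal c (n * t) := by
  induction n with
  | zero => ext <;> simp [ofReal]
  | succ n ih =>
    rw [pow_succ, ih, mul_ofReal]
    ext
    · rfl
    · simp only [ofReal]
      push_cast
      ring

end Extension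

/-- A bounded cocycle on a group with a nontrivial law is the coboundary of a bounded function. -/
theorem exists_bounded_primitive {ι : Type*} {w : FreeGroup ι} (hw : w ≠ 1)
    (hlaw : ∀ f : ι → Γ, FreeGroup.lift f w = 1) (hc : ∃ C, ∀ g h, |c.toFun g h| ≤ C) :
    ∃ β : Γ → ℝ, (∃ C, ∀ g, |β g| ≤ C) ∧ ∀ g h, c.toFun g h = β g + β h - β (g * h) := by
  have hE (f : ι → c.Extension) (z : c.Extension) : Commute (FreeGroup.lift f w) z := by
    refine Extension.commute_of_fst_eq_one ?_ z
    have e : FreeGroup.lift (fun i => (f i).fst) = (Extension.proj c).comp (FreeGroup.lift f) := by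
      ext i; simp [Extension.proj]
    rw [← hlaw fun i => (f i).fst, e]
    rfl
  -- On the extension, the pullback of `c` is the defect of the real coordinate.
  have hsnd : IsQuasimorphism (Extension.snd : c.Extension → ℝ) := by
    obtain ⟨C, hC⟩ := hc
    refine ⟨C, fun x y => ?_⟩
    convert hC x.fst y.fst using 2
    rw [Extension.snd_mul]
    ring
  obtain ⟨ψ, hψ, C, hC⟩ := hsnd.exists_homogeneous
  have hmul := hψ.map_mul_of_central_law hw hE
  -- The homogenization is the identity on the central copy of `ℝ`.
  have hreal (t : ℝ) : ψ (Extension.ofReal c t) = t := by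
    refine sub_eq_zero.1 (eq_zero_of_forall_nat_mul_abs_le (C := C + |c.toFun 1 1|) fun n => ?_)
    have h := hC (Extension.ofReal c t ^ n)
    rw [hψ.map_pow, Extension.ofReal_pow] at h
    rw [← Nat.abs_cast n, ← abs_mul]
    refine le_trans (le_of_eq ?_) ((abs_sub _ (c.toFun 1 1)).trans (add_le_add_left h _))
    congr 1
    simp only [Extension.ofReal]
    ring
  refine ⟨fun g => ψ ⟨g, 0⟩, ⟨C, fun g => by simpa using hC ⟨g, 0⟩⟩, fun g h => ?_⟩
  have h₁ := hmul ⟨g, 0⟩ ⟨h, 0⟩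
  have h₂ := hmul ⟨g * h, 0⟩ (Extension.ofReal c (c.toFun g h))
  have e : (⟨g, 0⟩ * ⟨h, 0⟩ : c.Extension)
      = ⟨g * h, 0⟩ * Extension.ofReal c (c.toFun g h) := by
    rw [Extension.mul_ofReal]
    ext
    · rfl
    · simp
  rw [e, h₂, hreal] at h₁
  linarith

end RealCocycle

end Extension

/-! ### Bounded cohomology in degree two -/

namespace BddCohomology

theorem invariants_one_iff {Γ : Type*} [Group Γ] {n : ℕ} {f : (Fin (n + 1) → Γ) → ℝ} :
    f ∈ invariants (1 : Γ →* (ℝ ≃ₗᵢ[ℝ] ℝ)) n ↔ ∀ γ g, f (fun i => γ⁻¹ * g i) = f g :=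
  Iff.rfl

theorem coboundary_one_apply {Γ : Type*} (f : (Fin 2 → Γ) → ℝ) (g : Fin 3 → Γ) :
    coboundary Γ ℝ 1 f g = f ![g 1, g 2] - f ![g 0, g 2] + f ![g 0, g 1] := by
  have e₀ : (fun j : Fin 2 => g (Fin.succAbove 0 j)) = ![g 1, g 2] := by
    ext j; fin_cases j <;> rfl
  have e₁ : (fun j : Fin 2 => g (Fin.succAbove 1 j)) = ![g 0, g 2] := by
    ext j; fin_cases j <;> rfl
  have e₂ : (fun j : Fin 2 => g (Fin.succAbove 2 j)) = ![g 0, g 1] := by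
    ext j; fin_cases j <;> rfl
  change ∑ i : Fin 3, (-1 : ℝ) ^ (i : ℕ) • f (fun j => g (i.succAbove j)) = _
  rw [Fin.sum_univ_three, e₀, e₁, e₂]
  simp
  ring

theorem coboundary_two_apply {Γ : Type*} (f : (Fin 3 → Γ) → ℝ) (g : Fin 4 → Γ) :
    coboundary Γ ℝ 2 f g = f ![g 1, g 2, g 3] - f ![g 0, g 2, g 3] + f ![g 0, g 1, g 3]
      - f ![g 0, g 1, g 2] := by
  have e₀ : (fun j : Fin 3 => g (Fin.succAbove 0 j)) = ![g 1, g 2, g 3] := by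
    ext j; fin_cases j <;> rfl
  have e₁ : (fun j : Fin 3 => g (Fin.succAbove 1 j)) = ![g 0, g 2, g 3] := by
    ext j; fin_cases j <;> rfl
  have e₂ : (fun j : Fin 3 => g (Fin.succAbove 2 j)) = ![g 0, g 1, g 3] := by
    ext j; fin_cases j <;> rfl
  have e₃ : (fun j : Fin 3 => g (Fin.succAbove 3 j)) = ![g 0, g 1, g 2] := by
    ext j; fin_cases j <;> rfl
  change ∑ i : Fin 4, (-1 : ℝ) ^ (i : ℕ) • f (fun j => g (i.succAbove j)) = _
  rw [Fin.sum_univ_four, e₀, e₁, e₂, e₃]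
  simp [pow_succ]
  ring

variable {Γ : Type*} [Group Γ]

/-- An invariant 2-cochain is determined by its inhomogeneous form `(g, h) ↦ f (1, g, g * h)`. -/
theorem eq_of_mem_invariants {f : (Fin 3 → Γ) → ℝ}
    (hf : f ∈ invariants (1 : Γ →* (ℝ ≃ₗᵢ[ℝ] ℝ)) 2) (x y z : Γ) :
    f ![x, y, z] = f ![1, x⁻¹ * y, x⁻¹ * z] := by
  rw [← invariants_one_iff.1 hf x ![x, y, z]]
  congr 1
  ext i
  fin_cases i <;> simp

/-- The inhomogeneous form of an invariant 2-cocycle. -/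
def inhomogeneousCocycle (f : (Fin 3 → Γ) → ℝ)
    (hf : f ∈ invariants (1 : Γ →* (ℝ ≃ₗᵢ[ℝ] ℝ)) 2) (hδ : coboundary Γ ℝ 2 f = 0) :
    RealCocycle Γ where
  toFun g h := f ![1, g, g * h]
  cocycle g h k := by
    have h₁ := congrFun hδ ![1, g, g * h, g * h * k]
    rw [coboundary_two_apply] at h₁
    simp only [Matrix.cons_val, Pi.zero_apply] at h₁
    rw [eq_of_mem_invariants hf g, eq_of_mem_invariants hf 1 (g * h)] at h₁
    simp only [inv_mul_cancel_left, inv_one, one_mul, mul_assoc] at h₁ ⊢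
    linarith

end BddCohomology

open BddCohomology in
theorem mainTheorem7 {Γ : Type*} [Group Γ] {F : Type*} [Group F] [IsFreeGroup F]
    (ω : F) (hω : ω ≠ 1) (hlaw : IsGroupLaw ω Γ) :
    Subsingleton (RealBddCohomology Γ 2) := by
  have hw : IsFreeGroup.toFreeGroup F ω ≠ 1 := by simpa using hω
  have hlaw' (ρ : IsFreeGroup.Generators F → Γ) :
      FreeGroup.lift ρ (IsFreeGroup.toFreeGroup F ω) = 1 :=
    hlaw ((FreeGroup.lift ρ).comp (IsFreeGroup.toFreeGroup F).toMonoidHom)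
  rw [Submodule.Quotient.subsingleton_iff, Submodule.submoduleOf_eq_top]
  rintro f ⟨hδ, ⟨C, hC⟩, hinv⟩
  obtain ⟨β, ⟨B, hB⟩, hβ⟩ :=
    (inhomogeneousCocycle f hinv hδ).exists_bounded_primitive hw hlaw' ⟨C, fun g h => hC _⟩
  refine ⟨fun g => β ((g 0)⁻¹ * g 1), ⟨⟨B, fun g => hB _⟩, fun γ g => ?_⟩, ?_⟩
  · change β ((γ⁻¹ * g 0)⁻¹ * (γ⁻¹ * g 1)) = β ((g 0)⁻¹ * g 1)
    congr 1
    group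
  · ext g
    have h := hβ ((g 0)⁻¹ * g 1) ((g 1)⁻¹ * g 2)
    have e : f g = f ![1, (g 0)⁻¹ * g 1, (g 0)⁻¹ * g 2] := by
      rw [← eq_of_mem_invariants hinv]
      congr 1
      ext i
      fin_cases i <;> rfl
    have e' : (g 0)⁻¹ * g 1 * ((g 1)⁻¹ * g 2) = (g 0)⁻¹ * g 2 := by group
    rw [coboundary_one_apply, e]
    simp only [inhomogeneousCocycle, e'] at h
    simp only [Matrix.cons_val]
    linarith
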